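/- Let $n\ge 0$, let $F_n$ be the free group on $X=\{x_1,\dots,x_n\}$, and let $\rho:F_n\to\mathbb{Z}^n$ be the abelianisation map sending $x_i$ to the $i$-th standard basis vector $v_i$. A palindrome is an element of $F_n$ represented by a word on $X^{\pm1}$ that equals its own reverse. A $\pi$-basis of $F_n$ is a set of palindromes that is a free basis of $F_n$, and a partial $\pi$-basis is a subset of a $\pi$-basis. The complex of partial $\pi$-bases $\mathcal{B}^{\pi}_n$ is the simplicial complex whose simplices are the nonempty partial $\pi$-bases $\{w_1,\dots,w_k\}$. The palindromic Torelli group $\mathcal{PI}_n$ is the group of automorphisms of $F_n$ that take each $x_i$ to a palindrome and act trivially on the abelianisation of $F_n$. An odd palindrome in $\mathbb{Z}^n$ is a vector of the form $2w\pm v_i$ with $w\in\mathbb{Z}^n$, $1\le i\le n$; a $\pi$-basis of $\mathbb{Z}^n$ is a free abelian basis consisting of odd palindromes; and $\mathcal{B}^{\pi}_n(\mathbb{Z})$ is the simplicial complex whose simplices are the nonempty subsets of $\pi$-bases of $\mathbb{Z}^n$. The group $\mathcal{PI}_n$ acts simplicially on $\mathcal{B}^{\pi}_n$. Let $\mathcal{B}^{\pi}_n/\mathcal{PI}_n$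 be the simplicial complex whose vertices are the $\mathcal{PI}_n$-orbits of vertices of $\mathcal{B}^{\pi}_n$ and whose simplices are the sets of orbits of the vertices of simplices of $\mathcal{B}^{\pi}_n$. Theorem. There is an isomorphism of simplicial complexes $$\mathcal{B}^{\pi}_n/\mathcal{PI}_n\;\cong\;\mathcal{B}^{\pi}_n(\mathbb{Z})$$ induced by abelianisation, that is, taking the orbit of each vertex $w$ to $\rho(w)$. Moreover, $\mathcal{B}^{\pi}_n/\mathcal{PI}_n$ is the genuine orbit space: distinct vertices of a simplex of $\mathcal{B}^{\pi}_n$ lie in distinct $\mathcal{PI}_n$-orbits, and two simplices of $\mathcal{B}^{\pi}_n$ whose vertices represent the same set of orbits lie in the same $\mathcal{PI}_n$-orbit. -/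

import Mathlib

namespace PalindromicTorelli

/-! ### Simplicial complexes, their quotients and their isomorphisms -/

/-- The set of vertices of a simplicial complex. -/
def vertices {α : Type*} (K : PreAbstractSimplicialComplex α) : Set α :=
  {v | {v} ∈ K.faces}

/-- An isomorphism of simplicial complexes: a bijection of the vertex sets under which a finite
set of vertices spans a simplex if and only if its image does. -/
structure SimplicialIso {α β : Type*} (K : PreAbstractSimplicialComplex α)
    (L : PreAbstractSimplicialComplex β) where
  toEquiv : vertices K ≃ vertices L
  map_faces_iff : ∀ s : Finset (vertices K),
    s.map (Function.Embedding.subtype _) ∈ K.faces ↔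
      (s.map toEquiv.toEmbedding).map (Function.Embedding.subtype _) ∈ L.faces

/-- The action of `G` on `α` takes simplices of `K` to simplices of `K`. -/
def ActsSimplicially (G : Type*) {α : Type*} [Group G] [MulAction G α]
    (K : PreAbstractSimplicialComplex α) : Prop :=
  ∀ (g : G), ∀ s ∈ K.faces, s.map (MulAction.toPerm g).toEmbedding ∈ K.faces

open Classical in
/-- The quotient of a simplicial complex by a simplicial group action: the vertices are the
orbits of vertices, and a set of orbits spans a simplex if it is the set of orbits of the
vertices of some simplex of `K`. -/
noncomputable def quotientComplex (G : Type*) {α : Type*} [Group G] [MulAction G α]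
    (K : PreAbstractSimplicialComplex α) (_hK : ActsSimplicially G K) :
    PreAbstractSimplicialComplex (MulAction.orbitRel.Quotient G α) :=
  K.map (fun v => (Quotient.mk _ v : MulAction.orbitRel.Quotient G α))

/-- The vertex of the quotient complex given by the orbit of a vertex. -/
noncomputable def quotientVertex (G : Type*) {α : Type*} [Group G] [MulAction G α]
    (K : PreAbstractSimplicialComplex α) (hK : ActsSimplicially G K) (v : vertices K) :
    vertices (quotientComplex G K hK) :=
  ⟨Quotient.mk _ v.1, by
    classical
    exact ⟨{v.1}, v.2, by simp⟩⟩

/-! ### Palindromes and palindromic automorphisms -/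

/-- An element of the free group is a palindrome if it is represented by some (not necessarily
reduced) word in the letters and their inverses that equals its own reverse. -/
def IsPalindrome {α : Type*} (g : FreeGroup α) : Prop :=
  ∃ L : List (α × Bool), L.reverse = L ∧ FreeGroup.mk L = g

/-- The endomorphism of the free group that inverts each free generator. -/
def inversion (α : Type*) : FreeGroup α →* FreeGroup α :=
  FreeGroup.lift (fun x => (FreeGroup.of x)⁻¹)

theorem inversion_mk {α : Type*} (L : List (α × Bool)) :
    inversion α (FreeGroup.mk L) = FreeGroup.mk (L.map fun p => (p.1, !p.2)) := by
  induction L with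
  | nil => rfl
  | cons p L ih =>
    have h1 : FreeGroup.mk (p :: L) = FreeGroup.mk [p] * FreeGroup.mk L := by
      simp
    have h2 : FreeGroup.mk ((p :: L).map fun p => (p.1, !p.2)) =
        FreeGroup.mk [(p.1, !p.2)] * FreeGroup.mk (L.map fun p => (p.1, !p.2)) := by
      simp
    rw [h1, map_mul, ih, h2]
    congr 1
    obtain ⟨x, b⟩ := p
    cases b <;> simp [inversion, FreeGroup.of, FreeGroup.invRev]

theorem isPalindrome_iff {α : Type*} (g : FreeGroup α) :
    IsPalindrome g ↔ inversion α g = g⁻¹ := by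
  classical
  constructor
  · rintro ⟨L, hL, rfl⟩
    rw [inversion_mk, FreeGroup.inv_mk, FreeGroup.invRev, ← List.map_reverse, hL]
  · intro h
    refine ⟨g.toWord, ?_, FreeGroup.mk_toWord⟩
    have hr : FreeGroup.IsReduced g.toWord := FreeGroup.isReduced_toWord
    have hm : FreeGroup.IsReduced (g.toWord.map fun p => (p.1, !p.2)) := by
      unfold FreeGroup.IsReduced at hr ⊢
      rw [List.isChain_map]
      exact hr.imp (by intro a b hab h; simp [hab h])
    have hm' : FreeGroup.IsReduced (g.toWord.map fun p => (p.1, !p.2)).reverse := by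
      unfold FreeGroup.IsReduced at hm ⊢
      rw [List.isChain_reverse]
      exact hm.imp (by intro a b hab h; exact (hab h.symm).symm)
    have h' : FreeGroup.mk (g.toWord.map fun p => (p.1, !p.2)) =
        FreeGroup.mk (g.toWord.map fun p => (p.1, !p.2)).reverse := by
      rw [← inversion_mk, FreeGroup.mk_toWord, h]
      conv_lhs => rw [← FreeGroup.mk_toWord (x := g), FreeGroup.inv_mk, FreeGroup.invRev]
    have h2 := congrArg FreeGroup.toWord h'
    rw [FreeGroup.toWord_mk, FreeGroup.toWord_mk, hm.reduce_eq, hm'.reduce_eq,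
      ← List.map_reverse] at h2
    refine (List.map_injective_iff.2 ?_ h2).symm
    rintro ⟨a, b⟩ ⟨c, d⟩ hab
    simpa using hab

theorem commutes_iff {α : Type*} (φ : MulAut (FreeGroup α)) :
    (∀ x : α, IsPalindrome (φ (FreeGroup.of x))) ↔
      ∀ g, inversion α (φ g) = φ (inversion α g) := by
  constructor
  · intro h
    have : (inversion α).comp φ.toMonoidHom = φ.toMonoidHom.comp (inversion α) := by
      ext x
      have := (isPalindrome_iff _).1 (h x)
      simpa [inversion] using this
    exact fun g => DFunLike.congr_fun this g
  · intro h x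
    rw [isPalindrome_iff, h]
    simp [inversion]

/-- The palindromic automorphism group of the free group on `x_1, …, x_n`: the automorphisms
taking each `x_i` to a palindrome. -/
def palindromicAut (n : ℕ) : Subgroup (MulAut (FreeGroup (Fin n))) where
  carrier := {φ | ∀ i : Fin n, IsPalindrome (φ (FreeGroup.of i))}
  one_mem' := fun i => ⟨[(i, true)], rfl, rfl⟩
  mul_mem' := by
    intro φ ψ hφ hψ
    rw [Set.mem_ofPred_eq, commutes_iff] at *
    intro g
    rw [MulAut.mul_apply, MulAut.mul_apply, hφ, hψ]
  inv_mem' := by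
    intro φ hφ
    rw [Set.mem_ofPred_eq, commutes_iff] at *
    intro g
    apply φ.injective
    rw [← hφ, MulAut.apply_inv_self, MulAut.apply_inv_self]

/-- The abelianisation map `F_n → ℤⁿ`, taking `x_i` to the `i`-th standard basis vector. -/
def abMap (n : ℕ) : FreeGroup (Fin n) →* Multiplicative (Fin n → ℤ) :=
  FreeGroup.lift (fun i => Multiplicative.ofAdd (Pi.single i 1))

/-- The abelianisation map as a map to the additive group `ℤⁿ`. -/
def rho (n : ℕ) (w : FreeGroup (Fin n)) : Fin n → ℤ :=
  Multiplicative.toAdd (abMap n w)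

/-- The palindromic Torelli group: the palindromic automorphisms of `F_n` that act trivially on
the abelianisation of `F_n`. -/
def palindromicTorelli (n : ℕ) : Subgroup (MulAut (FreeGroup (Fin n))) where
  carrier := {φ | φ ∈ palindromicAut n ∧ ∀ g, rho n (φ g) = rho n g}
  one_mem' := ⟨(palindromicAut n).one_mem, fun _ => rfl⟩
  mul_mem' := by
    rintro φ ψ ⟨h1, h2⟩ ⟨h3, h4⟩
    exact ⟨(palindromicAut n).mul_mem h1 h3, fun g => by rw [MulAut.mul_apply, h2, h4]⟩
  inv_mem' := by
    rintro φ ⟨h1, h2⟩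
    exact ⟨(palindromicAut n).inv_mem h1, fun g => by rw [← h2, MulAut.apply_inv_self]⟩

/-! ### The complex of partial π-bases of the free group -/

/-- A π-basis of `F_n`: a set of palindromes that is a free basis of `F_n`. -/
def IsPiBasis (n : ℕ) (B : Set (FreeGroup (Fin n))) : Prop :=
  (∀ w ∈ B, IsPalindrome w) ∧
    ∃ b : FreeGroupBasis B (FreeGroup (Fin n)), ∀ w : B, b w = w

/-- The complex of partial π-bases of `F_n`: its simplices are the nonempty finite sets that
can be extended to a π-basis. -/
def piComplex (n : ℕ) : PreAbstractSimplicialComplex (FreeGroup (Fin n)) where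
  faces := {s | s.Nonempty ∧ ∃ B, IsPiBasis n B ∧ (s : Set (FreeGroup (Fin n))) ⊆ B}
  isRelLowerSet_faces := by
    rintro s ⟨hs, B, hB, hsB⟩
    exact ⟨hs, fun t hts ht => ⟨ht, B, hB, (Finset.coe_subset.2 hts).trans hsB⟩⟩

theorem IsPiBasis.image {n : ℕ} {B : Set (FreeGroup (Fin n))} (hB : IsPiBasis n B)
    {φ : MulAut (FreeGroup (Fin n))} (hφ : φ ∈ palindromicAut n) : IsPiBasis n (φ '' B) := by
  obtain ⟨hpal, b, hb⟩ := hB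
  have hc := (commutes_iff φ).1 hφ
  refine ⟨?_, ?_⟩
  · rintro _ ⟨w, hw, rfl⟩
    rw [isPalindrome_iff, hc, (isPalindrome_iff w).1 (hpal w hw), map_inv]
  · refine ⟨(b.map φ).reindex (φ.toEquiv.image B), ?_⟩
    rintro ⟨_, w, hw, rfl⟩
    have : (φ.toEquiv.image B).symm ⟨φ w, w, hw, rfl⟩ = ⟨w, hw⟩ := by
      rw [Equiv.symm_apply_eq]; rfl
    simp only [FreeGroupBasis.reindex_apply, FreeGroupBasis.map_apply]
    erw [this, hb]

/-- The palindromic Torelli group acts simplicially on the complex of partial π-bases. -/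
theorem actsSimplicially (n : ℕ) : ActsSimplicially (palindromicTorelli n) (piComplex n) := by
  rintro ⟨φ, hφ⟩ s ⟨hs, B, hB, hsB⟩
  refine ⟨hs.map, φ '' B, hB.image hφ.1, ?_⟩
  rw [Finset.coe_map]
  exact Set.image_mono hsB

/-! ### The complex of partial π-bases of `ℤⁿ` -/

/-- An element of `ℤⁿ` is an odd palindrome on the standard basis `v_1, …, v_n` if it is of the
form `w^rev v_i^{±1} w` in multiplicative notation; as `w^rev = w` in `ℤⁿ`, this reads
`w ± v_i + w` in additive notation. -/
def IsOddPalindromeZ {n : ℕ} (u : Fin n → ℤ) : Prop :=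
  ∃ (w : Fin n → ℤ) (i : Fin n) (ε : ℤˣ), u = w + Pi.single i (ε : ℤ) + w

/-- A π-basis of `ℤⁿ`: a set of odd palindromes that is a free abelian basis of `ℤⁿ`. -/
def IsPiBasisZ (n : ℕ) (B : Set (Fin n → ℤ)) : Prop :=
  (∀ u ∈ B, IsOddPalindromeZ u) ∧
    ∃ b : Module.Basis B ℤ (Fin n → ℤ), ∀ u : B, b u = u

/-- The complex of partial π-bases of `ℤⁿ`: its simplices are the nonempty finite sets that can
be extended to a π-basis. -/
def piComplexZ (n : ℕ) : PreAbstractSimplicialComplex (Fin n → ℤ) where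
  faces := {s | s.Nonempty ∧ ∃ B, IsPiBasisZ n B ∧ (s : Set (Fin n → ℤ)) ⊆ B}
  isRelLowerSet_faces := by
    rintro s ⟨hs, B, hB, hsB⟩
    exact ⟨hs, fun t hts ht => ⟨ht, B, hB, (Finset.coe_subset.2 hts).trans hsB⟩⟩

end PalindromicTorelli

/-!
Modulo two the abelianisation of a palindrome is zero or a standard basis vector, so every π-basis,
suitably ordered, is the image of the standard basis under an automorphism whose abelianisation is
congruent to the identity modulo two; similarly the π-bases of `ℤⁿ` are, up to order, the sets of
columns of the matrices in the level two congruence subgroup of `GL(n, ℤ)`. The heart of the matter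
is a relative lifting statement: such a matrix that fixes some of the standard basis vectors is
induced by a palindromic automorphism of `F_n` that fixes the corresponding generators. Indeed, the
Euclidean algorithm on one column at a time writes the matrix as a product of sign changes and of
transvections with even coefficient `e_b ↦ e_b + 2 e_a`, all fixing the given basis vectors, and
these lift to `x_j ↦ x_j⁻¹` and to `x_b ↦ x_a x_b x_a`. Hence a partial π-basis of `F_n` extends to
a π-basis over any given π-basis of `ℤⁿ` containing its image, so that two partial π-bases with the
same image differ by an automorphism in the Torelli group.
-/

namespace PalindromicTorelli

section SimplicialComplex

variable {α β : Type*}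

theorem mem_vertices_of_mem_face {K : PreAbstractSimplicialComplex α} {s : Finset α}
    (hs : s ∈ K.faces) {v : α} (hv : v ∈ s) : v ∈ vertices K :=
  (K.isRelLowerSet_faces hs).2 (Finset.singleton_subset_iff.2 hv) (Finset.singleton_nonempty v)

theorem mem_vertices_map_iff [DecidableEq β] {K : PreAbstractSimplicialComplex α} {f : α → β}
    {u : β} : u ∈ vertices (K.map f) ↔ ∃ v ∈ vertices K, f v = u := by
  constructor
  · rintro ⟨s, hs, hsu⟩
    obtain ⟨v, hv, rfl⟩ := Finset.mem_image.1 (hsu ▸ Finset.mem_singleton_self u)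
    exact ⟨v, mem_vertices_of_mem_face hs hv, rfl⟩
  · rintro ⟨v, hv, rfl⟩
    exact ⟨{v}, hv, Finset.image_singleton f v⟩

theorem complex_map_map {γ : Type*} [DecidableEq β] [DecidableEq γ]
    (K : PreAbstractSimplicialComplex α) (f : α → β) (g : β → γ) :
    (K.map f).map g = K.map (g ∘ f) := by
  ext s
  simp [PreAbstractSimplicialComplex.map, Finset.image_image]

theorem image_mem_faces_map_iff [DecidableEq β] {K : PreAbstractSimplicialComplex α} {f : α → β}
    (hf : Set.InjOn f (vertices K)) {s : Finset α} (hs : (s : Set α) ⊆ vertices K) :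
    s.image f ∈ (K.map f).faces ↔ s ∈ K.faces := by
  refine ⟨?_, fun h => ⟨s, h, rfl⟩⟩
  rintro ⟨t, ht, hts⟩
  have hst : (t : Set α) = s := (hf.image_eq_image_iff (fun v => mem_vertices_of_mem_face ht) hs).1
    (by simpa only [Finset.coe_image] using congrArg (fun u : Finset β => (u : Set β)) hts)
  exact Finset.coe_injective hst ▸ ht

/-- A map that is injective on the vertices of a complex, as an isomorphism onto the image
complex. -/
noncomputable def isoMapOfInjOn [DecidableEq β] (K : PreAbstractSimplicialComplex α) {f : α → β}
    (hf : Set.InjOn f (vertices K)) : SimplicialIso K (K.map f) where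
  toEquiv := Set.BijOn.equiv f
    ⟨fun v hv => mem_vertices_map_iff.2 ⟨v, hv, rfl⟩, hf, fun _ hu => mem_vertices_map_iff.1 hu⟩
  map_faces_iff s := by
    classical
    rw [← image_mem_faces_map_iff hf (by simp)]
    simp only [Finset.map_eq_image, Finset.image_image]
    rfl

theorem exists_simplicialIso_quotientComplex [DecidableEq β] {G : Type*} [Group G] [MulAction G α]
    {K : PreAbstractSimplicialComplex α} (hK : ActsSimplicially G K) {f : α → β}
    (hinv : ∀ (g : G) v, f (g • v) = f v)
    (hsep : ∀ v ∈ vertices K, ∀ w ∈ vertices K, f v = f w → v ∈ MulAction.orbit G w) :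
    ∃ e : SimplicialIso (quotientComplex G K hK) (K.map f),
      ∀ v : vertices K, (e.toEquiv (quotientVertex G K hK v) : β) = f v := by
  classical
  let fbar : MulAction.orbitRel.Quotient G α → β := Quotient.lift f <| by
    rintro _ w ⟨g, rfl⟩
    exact hinv g w
  have hmap : (quotientComplex G K hK).map fbar = K.map f := by
    rw [quotientComplex, complex_map_map]
    congr!
  have hinj : Set.InjOn fbar (vertices (quotientComplex G K hK)) := by
    intro q hq r hr hqr
    obtain ⟨v, hv, rfl⟩ := mem_vertices_map_iff.1 hq
    obtain ⟨w, hw, rfl⟩ := mem_vertices_map_iff.1 hr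
    exact Quotient.sound (hsep v hv w hw hqr)
  rw [← hmap]
  exact ⟨isoMapOfInjOn _ hinj, fun v => rfl⟩

end SimplicialComplex

section LevelTwo

variable {ι κ : Type*}

/-- The group `GL(ι, ℤ)`, as the group of automorphisms of `ℤ^ι`. -/
abbrev IntegralGL (ι : Type*) := (ι → ℤ) ≃ₗ[ℤ] (ι → ℤ)

/-- Reduction modulo two `ℤ^ι → (ℤ/2)^ι`. -/
def modTwo : (ι → ℤ) →ₗ[ℤ] (ι → ZMod 2) :=
  (Int.castAddHom (ZMod 2)).toIntLinearMap.compLeft ι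

@[simp]
theorem modTwo_apply (v : ι → ℤ) (k : ι) : modTwo v k = v k := rfl

@[simp]
theorem modTwo_single [DecidableEq ι] (j : ι) (a : ℤ) :
    modTwo (Pi.single j a) = Pi.single j (a : ZMod 2) :=
  funext fun k =>
    Pi.apply_single (fun _ => (Int.cast : ℤ → ZMod 2)) (fun _ => Int.cast_zero) j a k

theorem modTwo_add_add_self (u v : ι → ℤ) : modTwo (u + v + u) = modTwo v := by
  ext k
  simp [add_right_comm, CharTwo.add_self_eq_zero]

theorem modTwo_eq_iff {u v : ι → ℤ} : modTwo u = modTwo v ↔ ∀ k, (2 : ℤ) ∣ v k - u k := by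
  simp only [funext_iff, modTwo_apply]
  exact forall_congr' fun k => ZMod.intCast_eq_intCast_iff_dvd_sub _ _ 2

theorem linearEquiv_ext_single [Finite ι] [DecidableEq ι] {R M : Type*} [Semiring R]
    [AddCommMonoid M] [Module R M] {A B : (ι → R) ≃ₗ[R] M}
    (h : ∀ i, A (Pi.single i 1) = B (Pi.single i 1)) : A = B :=
  (Pi.basisFun R ι).ext' fun i => by simpa only [Pi.basisFun_apply] using h i

/-- The level two congruence subgroup of `GL(ι, ℤ)`. -/
def levelTwo (ι : Type*) : Subgroup (IntegralGL ι) where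
  carrier := {A | ∀ v, modTwo (A v) = modTwo v}
  one_mem' _ := rfl
  mul_mem' hA hB v := (hA _).trans (hB v)
  inv_mem' {A} hA v := by rw [← hA, ← LinearEquiv.mul_apply, mul_inv_cancel]; rfl

theorem mem_levelTwo_iff [Finite ι] [DecidableEq ι] {A : IntegralGL ι} :
    A ∈ levelTwo ι ↔ ∀ i, modTwo (A (Pi.single i 1)) = Pi.single i 1 := by
  refine ⟨fun hA i => by simpa using hA (Pi.single i 1), fun h v => ?_⟩
  have : modTwo ∘ₗ A.toLinearMap = modTwo :=
    (Pi.basisFun ℤ ι).ext fun i => by simpa using h i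
  exact LinearMap.congr_fun this v

theorem eq_of_apply_single_eq [DecidableEq ι] {A B : IntegralGL ι} (hA : A ∈ levelTwo ι)
    (hB : B ∈ levelTwo ι) {i j : ι} (h : A (Pi.single i 1) = B (Pi.single j 1)) : i = j := by
  have : (Pi.single i 1 : ι → ZMod 2) = Pi.single j 1 := by
    simpa using (hA (Pi.single i 1)).symm.trans ((congrArg modTwo h).trans (hB (Pi.single j 1)))
  by_contra hij
  simpa [hij] using congrFun this i

theorem exists_equiv_modTwo_basis_eq_single [Finite ι] [DecidableEq ι]
    (b : Module.Basis κ ℤ (ι → ℤ))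
    (hb : ∀ k, modTwo (b k) = 0 ∨ ∃ j, modTwo (b k) = Pi.single j 1) :
    ∃ e : ι ≃ κ, ∀ j, modTwo (b (e j)) = Pi.single j 1 := by
  have hsurj : ∀ j, ∃ k, modTwo (b k) = Pi.single j 1 := by
    intro j
    by_contra! hj
    -- Otherwise the `j`-th coordinate vanishes modulo two on the basis, hence everywhere.
    have hzero : LinearMap.proj (R := ℤ) (φ := fun _ : ι => ZMod 2) j ∘ₗ modTwo = 0 := by
      refine b.ext fun k => ?_
      rcases hb k with hk | ⟨i, hk⟩
      · simpa using congrFun hk j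
      · have hij : j ≠ i := by
          rintro rfl
          exact hj k hk
        simpa [hij] using congrFun hk j
    simpa using LinearMap.congr_fun hzero (Pi.single j 1)
  choose f hf using hsurj
  have hinj : Function.Injective f := by
    intro i j hij
    have : (Pi.single i 1 : ι → ZMod 2) = Pi.single j 1 := by rw [← hf, ← hf, hij]
    by_contra hne
    simpa [hne] using congrFun this i
  have hbij : Function.Bijective f := ⟨hinj, (Finite.injective_iff_surjective_of_equiv
    ((Pi.basisFun ℤ ι).indexEquiv b)).1 hinj⟩
  exact ⟨Equiv.ofBijective f hbij, hf⟩

theorem sum_natAbs_lt_sum_natAbs_of_eq_off [Fintype ι] {u v : ι → ℤ} {a : ι}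
    (hne : ∀ k ≠ a, u k = v k) (ha : (u a).natAbs < (v a).natAbs) :
    ∑ k, (u k).natAbs < ∑ k, (v k).natAbs := by
  refine Finset.sum_lt_sum (fun k _ => ?_) ⟨a, Finset.mem_univ a, ha⟩
  rcases eq_or_ne k a with rfl | hk
  · exact ha.le
  · rw [hne k hk]

variable [DecidableEq ι]

/-- The elementary matrix adding to the `a`-th coordinate twice the `b`-th one. -/
def evenTransvection {a b : ι} (hab : a ≠ b) : IntegralGL ι :=
  LinearEquiv.transvection (f := LinearMap.proj b) (v := Pi.single a 2) (by simp [hab.symm])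

/-- The diagonal matrix changing the sign of the `j`-th coordinate. -/
def signChange (j : ι) : IntegralGL ι :=
  Module.reflection (x := Pi.single j 1) (f := (2 : ℤ) • LinearMap.proj j) (by simp)

theorem evenTransvection_apply {a b : ι} (hab : a ≠ b) (v : ι → ℤ) :
    evenTransvection hab v = v + Pi.single a (2 * v b) := by
  ext k
  simp [evenTransvection, LinearMap.transvection.apply, Pi.single_apply, mul_comm]

theorem evenTransvection_inv_apply {a b : ι} (hab : a ≠ b) (v : ι → ℤ) :
    (evenTransvection hab)⁻¹ v = v - Pi.single a (2 * v b) := by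
  apply (evenTransvection hab).injective
  rw [← LinearEquiv.mul_apply, mul_inv_cancel, evenTransvection_apply]
  simp [hab.symm]

theorem signChange_apply (j : ι) (v : ι → ℤ) :
    signChange j v = v - Pi.single j (2 * v j) := by
  ext k
  simp [signChange, Module.reflection_apply, Pi.single_apply]

/-- The stabiliser in the level two congruence subgroup of the standard basis vectors indexed
outside `T`. -/
def levelTwoStabilizer (T : Finset ι) : Subgroup (IntegralGL ι) :=
  levelTwo ι ⊓ fixingSubgroup (IntegralGL ι)
    ((fun i => (Pi.single i 1 : ι → ℤ)) '' {i | i ∉ T})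

theorem mem_levelTwoStabilizer {T : Finset ι} {A : IntegralGL ι} :
    A ∈ levelTwoStabilizer T ↔
      A ∈ levelTwo ι ∧ ∀ i ∉ T, A (Pi.single i 1) = Pi.single i 1 := by
  simp [levelTwoStabilizer, mem_fixingSubgroup_iff]

/-- The group generated by the even transvections and the sign changes that fix the standard basis
vectors indexed outside `T`. -/
def evenElementary (T : Finset ι) : Subgroup (IntegralGL ι) :=
  Subgroup.closure ({A | ∃ (a b : ι) (hab : a ≠ b), b ∈ T ∧ A = evenTransvection hab} ∪
    signChange '' T)

theorem evenTransvection_mem_evenElementary {T : Finset ι} {a b : ι} (hab : a ≠ b) (hb : b ∈ T) :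
    evenTransvection hab ∈ evenElementary T :=
  Subgroup.subset_closure (Or.inl ⟨a, b, hab, hb, rfl⟩)

theorem signChange_mem_evenElementary {T : Finset ι} {j : ι} (hj : j ∈ T) :
    signChange j ∈ evenElementary T :=
  Subgroup.subset_closure (Or.inr ⟨j, hj, rfl⟩)

theorem evenElementary_le_iff {T : Finset ι} {H : Subgroup (IntegralGL ι)} :
    evenElementary T ≤ H ↔
      (∀ (a b : ι) (hab : a ≠ b), b ∈ T → evenTransvection hab ∈ H) ∧
        ∀ j ∈ T, signChange j ∈ H := by
  rw [evenElementary, Subgroup.closure_le, Set.union_subset_iff, Set.image_subset_iff]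
  refine and_congr_left' ⟨fun h a b hab hb => h ⟨a, b, hab, hb, rfl⟩, ?_⟩
  rintro h _ ⟨a, b, hab, hb, rfl⟩
  exact h a b hab hb

theorem evenElementary_mono {T U : Finset ι} (h : T ⊆ U) : evenElementary T ≤ evenElementary U :=
  evenElementary_le_iff.2 ⟨fun _ _ hab hb => evenTransvection_mem_evenElementary hab (h hb),
    fun _ hj => signChange_mem_evenElementary (h hj)⟩

theorem evenElementary_le_levelTwoStabilizer (T : Finset ι) :
    evenElementary T ≤ levelTwoStabilizer T := by
  have modTwo_single_two_mul : ∀ (i : ι) (c : ℤ), modTwo (Pi.single i (2 * c)) = 0 := by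
    intro i c
    rw [modTwo_single, ZMod.intCast_eq_zero_iff_even.2 (even_two_mul c), Pi.single_zero]
  refine evenElementary_le_iff.2 ⟨fun a b hab hb => mem_levelTwoStabilizer.2 ⟨fun v => ?_, ?_⟩,
    fun j hj => mem_levelTwoStabilizer.2 ⟨fun v => ?_, ?_⟩⟩
  · rw [evenTransvection_apply, map_add, modTwo_single_two_mul, add_zero]
  · intro i hi
    simp [evenTransvection_apply, ne_of_mem_of_not_mem hb hi]
  · rw [signChange_apply, map_sub, modTwo_single_two_mul, sub_zero]
  · intro i hi
    simp [signChange_apply, ne_of_mem_of_not_mem hj hi]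

theorem exists_mem_evenElementary_sum_natAbs_lt [Fintype ι] {T : Finset ι} {a b : ι} (hab : a ≠ b)
    (hb : b ∈ T) {v : ι → ℤ} (hvb : v b ≠ 0) (hlt : (v b).natAbs < (v a).natAbs) :
    ∃ g ∈ evenElementary T, ∑ k, (g v k).natAbs < ∑ k, (v k).natAbs := by
  have hmem := evenTransvection_mem_evenElementary hab hb
  have hcases : (v a + 2 * v b).natAbs < (v a).natAbs ∨
      (v a - 2 * v b).natAbs < (v a).natAbs := by omega
  rcases hcases with h | h
  · refine ⟨_, hmem, sum_natAbs_lt_sum_natAbs_of_eq_off (a := a) (fun k hk => ?_) ?_⟩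
    · simp [evenTransvection_apply, hk]
    · simpa [evenTransvection_apply] using h
  · refine ⟨_, inv_mem hmem, sum_natAbs_lt_sum_natAbs_of_eq_off (a := a) (fun k hk => ?_) ?_⟩
    · simp [evenTransvection_inv_apply, hk]
    · simpa [evenTransvection_inv_apply] using h

theorem isUnit_apply_single [Finite ι] {T : Finset ι} {A : IntegralGL ι}
    (hA : A ∈ levelTwoStabilizer T) {j : ι}
    (hzero : ∀ k ∈ T, k ≠ j → A (Pi.single j 1) k = 0) : IsUnit (A (Pi.single j 1) j) := by
  have hAinv := (mem_levelTwoStabilizer.1 (inv_mem hA)).2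
  have := Fintype.ofFinite ι
  have hexpand : ∀ v : ι → ℤ, A⁻¹ v j = ∑ k, v k * A⁻¹ (Pi.single k 1) j := by
    intro v
    conv_lhs => rw [← (Pi.basisFun ℤ ι).sum_repr v]
    simp only [map_sum, map_zsmul, Finset.sum_apply, Pi.smul_apply, Pi.basisFun_repr,
      Pi.basisFun_apply, smul_eq_mul]
  -- Off `j`, the column `A e_j` is supported outside `T`, where `A⁻¹` fixes the basis vectors.
  have hj : ∑ k, A (Pi.single j 1) k * A⁻¹ (Pi.single k 1) j =
      A (Pi.single j 1) j * A⁻¹ (Pi.single j 1) j := by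
    refine Finset.sum_eq_single_of_mem j (Finset.mem_univ j) fun k _ hkj => ?_
    by_cases hk : k ∈ T
    · rw [hzero k hk hkj, zero_mul]
    · rw [hAinv k hk, Pi.single_eq_of_ne' hkj, mul_zero]
  refine IsUnit.of_mul_eq_one (A⁻¹ (Pi.single j 1) j) ?_
  rw [← hj, ← hexpand, ← LinearEquiv.mul_apply, inv_mul_cancel]
  exact Pi.single_eq_same j 1

theorem even_apply_single {A : IntegralGL ι} (hA : A ∈ levelTwo ι) {j k : ι} (hk : k ≠ j) :
    Even (A (Pi.single j 1) k) := by
  rw [← ZMod.intCast_eq_zero_iff_even]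
  simpa [hk] using congrFun (hA (Pi.single j 1)) k

theorem odd_apply_single {A : IntegralGL ι} (hA : A ∈ levelTwo ι) (j : ι) :
    Odd (A (Pi.single j 1) j) := by
  rw [← ZMod.intCast_eq_one_iff_odd]
  simpa using congrFun (hA (Pi.single j 1)) j

theorem apply_single_eq_or_eq_neg [Finite ι] {T : Finset ι} {A : IntegralGL ι}
    (hA : A ∈ levelTwoStabilizer T) {j : ι}
    (hle : ∀ k ≠ j, (A (Pi.single j 1) k).natAbs ≤ (A (Pi.single j 1) j).natAbs)
    (hzero : ∀ k ∈ T, k ≠ j → A (Pi.single j 1) k = 0) :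
    A (Pi.single j 1) = Pi.single j 1 ∨ A (Pi.single j 1) = -Pi.single j 1 := by
  have hunit := isUnit_apply_single hA hzero
  have hoff : ∀ k ≠ j, A (Pi.single j 1) k = 0 := by
    intro k hk
    obtain ⟨c, hc⟩ := even_apply_single (mem_levelTwoStabilizer.1 hA).1 hk
    have := hle k hk
    rw [Int.isUnit_iff_natAbs_eq.1 hunit] at this
    omega
  have hsingle : A (Pi.single j 1) = Pi.single j (A (Pi.single j 1) j) := by
    ext k
    rcases eq_or_ne k j with rfl | hk
    · rw [Pi.single_eq_same]
    · rw [hoff k hk, Pi.single_eq_of_ne hk]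
  rcases Int.isUnit_iff.1 hunit with h | h
  · exact Or.inl (hsingle.trans (by rw [h]))
  · exact Or.inr (hsingle.trans (by rw [h, Pi.single_neg]))

theorem exists_natAbs_lt_or_apply_single_eq_or_eq_neg [Finite ι] {T : Finset ι}
    {A : IntegralGL ι} (hA : A ∈ levelTwoStabilizer T) {j : ι} (hj : j ∈ T) :
    (∃ a b, a ≠ b ∧ b ∈ T ∧ A (Pi.single j 1) b ≠ 0 ∧
      (A (Pi.single j 1) b).natAbs < (A (Pi.single j 1) a).natAbs) ∨
    A (Pi.single j 1) = Pi.single j 1 ∨ A (Pi.single j 1) = -Pi.single j 1 := by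
  have hlevel := (mem_levelTwoStabilizer.1 hA).1
  have hodd := odd_apply_single hlevel j
  by_cases hlarge : ∃ a ≠ j, (A (Pi.single j 1) j).natAbs < (A (Pi.single j 1) a).natAbs
  · obtain ⟨a, haj, hlt⟩ := hlarge
    exact Or.inl ⟨a, j, haj, hj, fun h => by simp [h] at hodd, hlt⟩
  push Not at hlarge
  by_cases hsmall : ∃ a ∈ T, a ≠ j ∧ A (Pi.single j 1) a ≠ 0
  · obtain ⟨a, ha, haj, hne⟩ := hsmall
    have hparity : (A (Pi.single j 1) a).natAbs ≠ (A (Pi.single j 1) j).natAbs := fun h =>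
      Int.not_even_iff_odd.2 hodd <|
        Int.natAbs_even.1 (h ▸ Int.natAbs_even.2 (even_apply_single hlevel haj))
    exact Or.inl ⟨j, a, haj.symm, ha, hne, (hlarge a haj).lt_of_ne hparity⟩
  push Not at hsmall
  exact Or.inr (apply_single_eq_or_eq_neg hA hlarge hsmall)

theorem exists_mem_evenElementary_mul_apply_single [Finite ι] {T : Finset ι} {A : IntegralGL ι}
    (hA : A ∈ levelTwoStabilizer T) {j : ι} (hj : j ∈ T) :
    ∃ g ∈ evenElementary T, (g * A) (Pi.single j 1) = Pi.single j 1 := by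
  have := Fintype.ofFinite ι
  induction hN : ∑ k, (A (Pi.single j 1) k).natAbs using Nat.strong_induction_on
    generalizing A with
  | _ N ih =>
  subst hN
  rcases exists_natAbs_lt_or_apply_single_eq_or_eq_neg hA hj with
    ⟨a, b, hab, hb, hne, hlt⟩ | h | h
  · obtain ⟨g, hg, hsum⟩ := exists_mem_evenElementary_sum_natAbs_lt hab hb hne hlt
    obtain ⟨g', hg', hfix⟩ :=
      ih _ hsum (mul_mem (evenElementary_le_levelTwoStabilizer T hg) hA) rfl
    exact ⟨g' * g, mul_mem hg' hg, by rwa [mul_assoc]⟩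
  · exact ⟨1, one_mem _, by rwa [one_mul]⟩
  · refine ⟨signChange j, signChange_mem_evenElementary hj, ?_⟩
    rw [LinearEquiv.mul_apply, h, map_neg, signChange_apply]
    ext k
    rcases eq_or_ne k j with rfl | hk <;> simp [*]

theorem evenElementary_eq_levelTwoStabilizer [Finite ι] (T : Finset ι) :
    evenElementary T = levelTwoStabilizer T := by
  refine (evenElementary_le_levelTwoStabilizer T).antisymm ?_
  induction T using Finset.induction_on with
  | empty =>
    intro A hA
    have : A = 1 := linearEquiv_ext_single fun i =>
      (mem_levelTwoStabilizer.1 hA).2 i (Finset.notMem_empty i)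
    exact this ▸ one_mem _
  | insert j T hj ih =>
    intro A hA
    obtain ⟨g, hg, hfix⟩ :=
      exists_mem_evenElementary_mul_apply_single hA (Finset.mem_insert_self j T)
    obtain ⟨hlevel, hfix'⟩ := mem_levelTwoStabilizer.1
      (mul_mem (evenElementary_le_levelTwoStabilizer _ hg) hA)
    refine (Subgroup.mul_mem_cancel_left _ hg).1 <|
      evenElementary_mono (Finset.subset_insert j T) <| ih <|
      mem_levelTwoStabilizer.2 ⟨hlevel, fun i hi => ?_⟩
    rcases eq_or_ne i j with rfl | hij
    · exact hfix
    · exact hfix' i (by simp [hi, hij])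

end LevelTwo

section ReplaceGen

variable {α : Type*} [DecidableEq α]

/-- The endomorphism of the free group sending the generator `j` to `w` and fixing the others. -/
def replaceGen (j : α) (w : FreeGroup α) : FreeGroup α →* FreeGroup α :=
  FreeGroup.lift (Function.update FreeGroup.of j w)

@[simp]
theorem replaceGen_of_self (j : α) (w : FreeGroup α) : replaceGen j w (FreeGroup.of j) = w := by
  simp [replaceGen]

@[simp]
theorem replaceGen_of_ne {i j : α} (h : i ≠ j) (w : FreeGroup α) :
    replaceGen j w (FreeGroup.of i) = FreeGroup.of i := by
  simp [replaceGen, h]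

theorem replaceGen_comp_replaceGen {j : α} {w w' : FreeGroup α}
    (h : replaceGen j w w' = FreeGroup.of j) :
    (replaceGen j w).comp (replaceGen j w') = MonoidHom.id _ := by
  ext i
  rcases eq_or_ne i j with rfl | hi
  · simpa using h
  · simp [hi]

/-- The automorphism of the free group given by `replaceGen j w`, with inverse
`replaceGen j w'`. -/
def replaceGenAut (j : α) (w w' : FreeGroup α) (h : replaceGen j w w' = FreeGroup.of j)
    (h' : replaceGen j w' w = FreeGroup.of j) : MulAut (FreeGroup α) :=
  MonoidHom.toMulEquiv (replaceGen j w) (replaceGen j w')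
    (replaceGen_comp_replaceGen h') (replaceGen_comp_replaceGen h)

section

variable {j : α} {w w' : FreeGroup α} {h : replaceGen j w w' = FreeGroup.of j}
  {h' : replaceGen j w' w = FreeGroup.of j}

@[simp]
theorem replaceGenAut_of_self : replaceGenAut j w w' h h' (FreeGroup.of j) = w :=
  replaceGen_of_self j w

@[simp]
theorem replaceGenAut_of_ne {i : α} (hi : i ≠ j) :
    replaceGenAut j w w' h h' (FreeGroup.of i) = FreeGroup.of i :=
  replaceGen_of_ne hi w

end

/-- The automorphism inverting the generator `j` and fixing the others. -/
def invertGen (j : α) : MulAut (FreeGroup α) :=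
  replaceGenAut j (FreeGroup.of j)⁻¹ (FreeGroup.of j)⁻¹ (by simp) (by simp)

/-- The automorphism sending the generator `b` to `a * b * a` and fixing the others. -/
def palindromicTransvection {a b : α} (hab : a ≠ b) : MulAut (FreeGroup α) :=
  replaceGenAut b (FreeGroup.of a * FreeGroup.of b * FreeGroup.of a)
    ((FreeGroup.of a)⁻¹ * FreeGroup.of b * (FreeGroup.of a)⁻¹)
    (by simp [hab, mul_assoc]) (by simp [hab, mul_assoc])

end ReplaceGen

section Abelianisation

variable {n : ℕ}

@[simp]
theorem rho_of (i : Fin n) : rho n (FreeGroup.of i) = Pi.single i 1 := by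
  simp [rho, abMap]

@[simp]
theorem rho_one : rho n 1 = 0 := by
  simp [rho]

@[simp]
theorem rho_mul (g h : FreeGroup (Fin n)) : rho n (g * h) = rho n g + rho n h := by
  simp [rho]

@[simp]
theorem rho_inv (g : FreeGroup (Fin n)) : rho n g⁻¹ = -rho n g := by
  simp [rho]

/-- The linear endomorphism of `ℤⁿ` induced by an endomorphism of `F_n`. -/
noncomputable def abLin (f : FreeGroup (Fin n) →* FreeGroup (Fin n)) :
    Module.End ℤ (Fin n → ℤ) :=
  (Pi.basisFun ℤ (Fin n)).constr ℤ fun i => rho n (f (FreeGroup.of i))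

@[simp]
theorem abLin_single (f : FreeGroup (Fin n) →* FreeGroup (Fin n)) (i : Fin n) :
    abLin f (Pi.single i 1) = rho n (f (FreeGroup.of i)) := by
  rw [← Pi.basisFun_apply, abLin, Module.Basis.constr_basis]

theorem abLin_rho (f : FreeGroup (Fin n) →* FreeGroup (Fin n)) (g : FreeGroup (Fin n)) :
    abLin f (rho n g) = rho n (f g) := by
  induction g using FreeGroup.induction_on with
  | C1 => simp
  | of i => rw [rho_of, abLin_single]
  | inv_of i h => rw [rho_inv, map_neg, map_inv, rho_inv, h]
  | mul g h hg hh => rw [rho_mul, map_add, map_mul, rho_mul, hg, hh]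

/-- The action of the automorphisms of `F_n` on the abelianisation `ℤⁿ`. -/
noncomputable def abAut (n : ℕ) : MulAut (FreeGroup (Fin n)) →* IntegralGL (Fin n) :=
  (LinearMap.GeneralLinearGroup.generalLinearEquiv ℤ (Fin n → ℤ)).toMonoidHom.comp
    (MonoidHom.toHomUnits
      { toFun := fun φ => abLin φ.toMonoidHom
        map_one' := (Pi.basisFun ℤ (Fin n)).ext fun i => by simp
        map_mul' := fun φ ψ => (Pi.basisFun ℤ (Fin n)).ext fun i => by simp [abLin_rho] })

theorem abAut_rho (φ : MulAut (FreeGroup (Fin n))) (g : FreeGroup (Fin n)) :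
    abAut n φ (rho n g) = rho n (φ g) :=
  abLin_rho φ.toMonoidHom g

@[simp]
theorem abAut_single (φ : MulAut (FreeGroup (Fin n))) (i : Fin n) :
    abAut n φ (Pi.single i 1) = rho n (φ (FreeGroup.of i)) :=
  abLin_single φ.toMonoidHom i

theorem mem_palindromicTorelli_iff {φ : MulAut (FreeGroup (Fin n))} :
    φ ∈ palindromicTorelli n ↔ φ ∈ palindromicAut n ∧ abAut n φ = 1 := by
  refine and_congr_right fun _ => ⟨fun h => ?_, fun h g => ?_⟩
  · exact linearEquiv_ext_single fun i => by
      rw [abAut_single, h, rho_of, LinearEquiv.coe_one, id_eq]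
  · rw [← abAut_rho, h, LinearEquiv.coe_one, id_eq]

theorem abAut_invertGen (j : Fin n) : abAut n (invertGen j) = signChange j := by
  refine linearEquiv_ext_single fun i => ?_
  rw [abAut_single, signChange_apply, invertGen]
  rcases eq_or_ne i j with rfl | hi
  · rw [replaceGenAut_of_self, rho_inv, rho_of, Pi.single_eq_same, ← Pi.single_sub, ← Pi.single_neg]
    rfl
  · simp [hi, hi.symm]

theorem abAut_palindromicTransvection {a b : Fin n} (hab : a ≠ b) :
    abAut n (palindromicTransvection hab) = evenTransvection hab := by
  refine linearEquiv_ext_single fun i => ?_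
  rw [abAut_single, evenTransvection_apply, palindromicTransvection]
  rcases eq_or_ne i b with rfl | hi
  · rw [replaceGenAut_of_self, Pi.single_eq_same, mul_one, ← one_add_one_eq_two, Pi.single_add]
    simp only [rho_mul, rho_of]
    abel
  · simp [hi, hi.symm]

/-- The stabiliser in the palindromic automorphism group of the generators indexed outside
`T`. -/
def palindromicStabilizer (T : Finset (Fin n)) : Subgroup (MulAut (FreeGroup (Fin n))) :=
  palindromicAut n ⊓ fixingSubgroup (MulAut (FreeGroup (Fin n))) (FreeGroup.of '' {i | i ∉ T})

theorem mem_palindromicStabilizer {T : Finset (Fin n)} {φ : MulAut (FreeGroup (Fin n))} :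
    φ ∈ palindromicStabilizer T ↔
      φ ∈ palindromicAut n ∧ ∀ i ∉ T, φ (FreeGroup.of i) = FreeGroup.of i := by
  simp [palindromicStabilizer, mem_fixingSubgroup_iff]

theorem replaceGenAut_mem_palindromicStabilizer {T : Finset (Fin n)} {j : Fin n} (hj : j ∈ T)
    {w w' : FreeGroup (Fin n)} (hw : IsPalindrome w) (h : replaceGen j w w' = FreeGroup.of j)
    (h' : replaceGen j w' w = FreeGroup.of j) :
    replaceGenAut j w w' h h' ∈ palindromicStabilizer T := by
  refine mem_palindromicStabilizer.2 ⟨fun i => ?_, fun i hi =>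
    replaceGenAut_of_ne (ne_of_mem_of_not_mem hj hi).symm⟩
  rcases eq_or_ne i j with rfl | hij
  · rwa [replaceGenAut_of_self]
  · rw [replaceGenAut_of_ne hij]
    exact ⟨[(i, true)], rfl, rfl⟩

theorem levelTwoStabilizer_le_map_palindromicStabilizer (T : Finset (Fin n)) :
    levelTwoStabilizer T ≤ (palindromicStabilizer T).map (abAut n) := by
  rw [← evenElementary_eq_levelTwoStabilizer, evenElementary_le_iff]
  refine ⟨fun a b hab hb => ?_, fun j hj => ?_⟩
  · rw [← abAut_palindromicTransvection]
    exact Subgroup.mem_map_of_mem _ <| replaceGenAut_mem_palindromicStabilizer hb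
      ⟨[(a, true), (b, true), (a, true)], rfl, rfl⟩ _ _
  · rw [← abAut_invertGen]
    exact Subgroup.mem_map_of_mem _ <| replaceGenAut_mem_palindromicStabilizer hj
      ⟨[(j, false)], rfl, rfl⟩ _ _

end Abelianisation

section PiBasis

variable {n : ℕ}

theorem IsPalindrome.modTwo_rho {w : FreeGroup (Fin n)} (hw : IsPalindrome w) :
    modTwo (rho n w) = 0 ∨ ∃ j, modTwo (rho n w) = Pi.single j 1 := by
  obtain ⟨L, hL, rfl⟩ := hw
  have hL := List.Palindrome.of_reverse_eq hL
  induction hL with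
  | nil => exact Or.inl (by rw [← FreeGroup.one_eq_mk, rho_one, map_zero])
  | singleton x =>
    obtain ⟨i, _ | _⟩ := x
    · refine Or.inr ⟨i, ?_⟩
      rw [show FreeGroup.mk [(i, false)] = (FreeGroup.of i)⁻¹ from rfl, rho_inv, rho_of,
        ← Pi.single_neg, modTwo_single]
      rfl
    · refine Or.inr ⟨i, ?_⟩
      rw [show FreeGroup.mk [(i, true)] = FreeGroup.of i from rfl, rho_of, modTwo_single]
      rfl
  | @cons_concat x l hl ih =>
    have hprod : FreeGroup.mk (x :: (l ++ [x])) =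
        FreeGroup.mk [x] * FreeGroup.mk l * FreeGroup.mk [x] := by
      simp
    have hmod : modTwo (rho n (FreeGroup.mk (x :: (l ++ [x])))) =
        modTwo (rho n (FreeGroup.mk l)) := by
      rw [hprod, rho_mul, rho_mul, modTwo_add_add_self]
    rw [hmod]
    exact ih hl.reverse_eq

theorem isOddPalindromeZ_iff {u : Fin n → ℤ} :
    IsOddPalindromeZ u ↔ ∃ j, modTwo u = Pi.single j 1 := by
  constructor
  · rintro ⟨w, j, ε, rfl⟩
    refine ⟨j, ?_⟩
    rw [modTwo_add_add_self, modTwo_single]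
    rcases Int.units_eq_one_or ε with rfl | rfl <;> rfl
  · rintro ⟨j, hj⟩
    have hdvd : ∀ k, (2 : ℤ) ∣ u k - (Pi.single j 1 : Fin n → ℤ) k :=
      modTwo_eq_iff.1 (by rw [hj, modTwo_single, Int.cast_one])
    choose w hw using hdvd
    refine ⟨w, j, 1, funext fun k => ?_⟩
    simp only [Pi.add_apply, Units.val_one]
    linarith [hw k]

/-- The automorphism of a free group sending the standard basis to another basis, with the two
index types identified along `e`. -/
noncomputable def basisAut {α κ : Type*} (b : FreeGroupBasis κ (FreeGroup α)) (e : α ≃ κ) :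
    MulAut (FreeGroup α) :=
  (b.reindex e.symm).repr.symm

theorem basisAut_of {α κ : Type*} (b : FreeGroupBasis κ (FreeGroup α)) (e : α ≃ κ) (i : α) :
    basisAut b e (FreeGroup.of i) = b (e i) :=
  b.reindex_apply e.symm i

theorem exists_basis_eq_rho {κ : Type*} (b : FreeGroupBasis κ (FreeGroup (Fin n))) :
    ∃ b' : Module.Basis κ ℤ (Fin n → ℤ), ∀ k, b' k = rho n (b k) := by
  let e : Fin n ≃ κ := Equiv.ofFreeGroupEquiv b.repr
  refine ⟨((Pi.basisFun ℤ (Fin n)).map (abAut n (basisAut b e))).reindex e, fun k => ?_⟩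
  rw [Module.Basis.reindex_apply, Module.Basis.map_apply, Pi.basisFun_apply, abAut_single,
    basisAut_of, Equiv.apply_symm_apply]

/-- The pure palindromic automorphism group of `F_n`: a palindromic automorphism permutes the
standard basis of the abelianisation modulo two, and the pure ones do so trivially. -/
noncomputable def purePalindromicAut (n : ℕ) : Subgroup (MulAut (FreeGroup (Fin n))) :=
  palindromicAut n ⊓ (levelTwo (Fin n)).comap (abAut n)

theorem isPiBasis_range {φ : MulAut (FreeGroup (Fin n))} (hφ : φ ∈ palindromicAut n) :
    IsPiBasis n (Set.range fun i => φ (FreeGroup.of i)) := by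
  have hinj := φ.injective.comp FreeGroup.of_injective
  refine ⟨Set.forall_mem_range.2 hφ, ((FreeGroupBasis.ofFreeGroup (Fin n)).map φ).reindex
    (Equiv.ofInjective _ hinj), ?_⟩
  rintro ⟨_, i, rfl⟩
  rw [FreeGroupBasis.reindex_apply, FreeGroupBasis.map_apply, FreeGroupBasis.ofFreeGroup_apply]
  exact congrArg (φ <| FreeGroup.of ·) (Equiv.ofInjective_symm_apply hinj i)

theorem isPiBasis_iff {B : Set (FreeGroup (Fin n))} :
    IsPiBasis n B ↔ ∃ φ ∈ purePalindromicAut n, B = Set.range fun i => φ (FreeGroup.of i) := by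
  refine ⟨fun ⟨hpal, b, hb⟩ => ?_, ?_⟩
  · obtain ⟨b', hb'⟩ := exists_basis_eq_rho b
    obtain ⟨e, he⟩ := exists_equiv_modTwo_basis_eq_single b' fun w => by
      rw [hb', hb]
      exact (hpal w w.2).modTwo_rho
    have hφ : ∀ i, basisAut b e (FreeGroup.of i) = e i := fun i => (basisAut_of b e i).trans (hb _)
    refine ⟨basisAut b e, ⟨fun i => hφ i ▸ hpal _ (e i).2, mem_levelTwo_iff.2 fun i => ?_⟩, ?_⟩
    · rw [abAut_single, hφ, ← hb, ← hb', he]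
    · simp only [hφ]
      exact ((e.surjective.range_comp Subtype.val).trans Subtype.range_coe).symm
  · rintro ⟨φ, hφ, rfl⟩
    exact isPiBasis_range hφ.1

theorem isPiBasisZ_iff {B : Set (Fin n → ℤ)} :
    IsPiBasisZ n B ↔ ∃ A ∈ levelTwo (Fin n), B = Set.range fun i => A (Pi.single i 1) := by
  refine ⟨fun ⟨hodd, b, hb⟩ => ?_, ?_⟩
  · obtain ⟨e, he⟩ := exists_equiv_modTwo_basis_eq_single b fun u =>
      Or.inr (hb u ▸ isOddPalindromeZ_iff.1 (hodd u u.2))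
    let A : IntegralGL (Fin n) := (Pi.basisFun ℤ (Fin n)).equiv b e
    have hA : ∀ i, A (Pi.single i 1) = e i := fun i => by
      rw [← hb, ← Pi.basisFun_apply, Module.Basis.equiv_apply]
    refine ⟨A, mem_levelTwo_iff.2 fun i => by rw [hA, ← hb, he], ?_⟩
    simp only [hA]
    exact ((e.surjective.range_comp Subtype.val).trans Subtype.range_coe).symm
  · rintro ⟨A, hA, rfl⟩
    have hinj : Function.Injective fun i : Fin n => A (Pi.single i 1) :=
      fun _ _ => eq_of_apply_single_eq hA hA
    refine ⟨Set.forall_mem_range.2 fun i => isOddPalindromeZ_iff.2 ⟨i, mem_levelTwo_iff.1 hA i⟩,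
      ((Pi.basisFun ℤ (Fin n)).map A).reindex (Equiv.ofInjective _ hinj), ?_⟩
    rintro ⟨_, i, rfl⟩
    rw [Module.Basis.reindex_apply, Module.Basis.map_apply, Pi.basisFun_apply,
      Equiv.ofInjective_symm_apply hinj i]

theorem IsPiBasis.image_rho {B : Set (FreeGroup (Fin n))} (hB : IsPiBasis n B) :
    IsPiBasisZ n (rho n '' B) := by
  obtain ⟨φ, ⟨-, hφ⟩, rfl⟩ := isPiBasis_iff.1 hB
  refine isPiBasisZ_iff.2 ⟨abAut n φ, hφ, ?_⟩
  simp only [← Set.range_comp', abAut_single]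

theorem IsPiBasis.injOn_rho {B : Set (FreeGroup (Fin n))} (hB : IsPiBasis n B) :
    Set.InjOn (rho n) B := by
  obtain ⟨φ, ⟨-, hφ⟩, rfl⟩ := isPiBasis_iff.1 hB
  rintro _ ⟨i, rfl⟩ _ ⟨j, rfl⟩ hij
  rw [← abAut_single, ← abAut_single] at hij
  rw [eq_of_apply_single_eq hφ hφ hij]

theorem IsPiBasis.exists_lift {B s : Set (FreeGroup (Fin n))} (hB : IsPiBasis n B) (hs : s ⊆ B)
    {C : Set (Fin n → ℤ)} (hC : IsPiBasisZ n C) (hsC : rho n '' s ⊆ C) :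
    ∃ D, IsPiBasis n D ∧ s ⊆ D ∧ rho n '' D = C := by
  classical
  obtain ⟨φ, ⟨hφpal, hφ⟩, rfl⟩ := isPiBasis_iff.1 hB
  obtain ⟨A, hA, rfl⟩ := isPiBasisZ_iff.1 hC
  let T : Finset (Fin n) := {i | φ (FreeGroup.of i) ∉ s}
  have hfix : (abAut n φ)⁻¹ * A ∈ levelTwoStabilizer T := by
    refine mem_levelTwoStabilizer.2 ⟨mul_mem (inv_mem hφ) hA, fun i hi => ?_⟩
    obtain ⟨j, hj⟩ := hsC ⟨φ (FreeGroup.of i), by simpa [T] using hi, rfl⟩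
    rw [← abAut_single] at hj
    obtain rfl := eq_of_apply_single_eq hA hφ hj
    exact ((abAut n φ).symm_apply_eq).2 hj
  obtain ⟨ψ, hψ, hψA⟩ := levelTwoStabilizer_le_map_palindromicStabilizer T hfix
  obtain ⟨hψpal, hψfix⟩ := mem_palindromicStabilizer.1 hψ
  refine ⟨_, isPiBasis_range (mul_mem hφpal hψpal), fun w hw => ?_, ?_⟩
  · obtain ⟨i, rfl⟩ := hs hw
    exact ⟨i, congrArg φ (hψfix i (by simpa [T] using hw))⟩
  · simp only [← Set.range_comp', ← abAut_single, map_mul, hψA, mul_inv_cancel_left]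

theorem IsPiBasis.exists_torelli {B C : Set (FreeGroup (Fin n))} (hB : IsPiBasis n B)
    (hC : IsPiBasis n C) (h : rho n '' B = rho n '' C) :
    ∃ φ ∈ palindromicTorelli n, φ '' B = C := by
  obtain ⟨φ, ⟨hφpal, hφ⟩, rfl⟩ := isPiBasis_iff.1 hB
  obtain ⟨ψ, ⟨hψpal, hψ⟩, rfl⟩ := isPiBasis_iff.1 hC
  have hab : abAut n φ = abAut n ψ := linearEquiv_ext_single fun i => by
    obtain ⟨_, ⟨j, rfl⟩, hj⟩ := h ▸ Set.mem_image_of_mem (rho n) (Set.mem_range_self i)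
    rw [← abAut_single, ← abAut_single] at hj
    obtain rfl := eq_of_apply_single_eq hψ hφ hj
    exact hj.symm
  refine ⟨ψ * φ⁻¹, mem_palindromicTorelli_iff.2 ⟨mul_mem hψpal (inv_mem hφpal), ?_⟩, ?_⟩
  · rw [map_mul, map_inv, hab, mul_inv_cancel]
  · simp only [← Set.range_comp', MulAut.mul_apply, MulAut.inv_apply_self]

end PiBasis

section Quotient

variable {n : ℕ}

theorem rho_eq_of_mem_orbit {v w : FreeGroup (Fin n)}
    (h : v ∈ MulAction.orbit (palindromicTorelli n) w) : rho n v = rho n w := by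
  obtain ⟨φ, rfl⟩ := h
  exact φ.2.2 w

theorem exists_torelli_of_image_rho_eq {s t : Finset (FreeGroup (Fin n))}
    (hs : s ∈ (piComplex n).faces) (ht : t ∈ (piComplex n).faces)
    (h : rho n '' (s : Set (FreeGroup (Fin n))) = rho n '' (t : Set (FreeGroup (Fin n)))) :
    ∃ φ : palindromicTorelli n, s.map (MulAction.toPerm φ).toEmbedding = t := by
  obtain ⟨-, B, hB, hsB⟩ := hs
  obtain ⟨-, C, hC, htC⟩ := ht
  obtain ⟨D, hD, htD, hDB⟩ := hC.exists_lift htC hB.image_rho (h ▸ Set.image_mono hsB)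
  obtain ⟨φ, hφ, rfl⟩ := hB.exists_torelli hD hDB.symm
  refine ⟨⟨φ, hφ⟩, Finset.coe_injective ?_⟩
  rw [Finset.coe_map]
  refine (hD.injOn_rho.image_eq_image_iff (Set.image_mono hsB) htD).1 ?_
  rw [← h, Set.image_image]
  exact Set.image_congr fun w _ => hφ.2 w

theorem mem_orbit_of_rho_eq {v w : FreeGroup (Fin n)} (hv : v ∈ vertices (piComplex n))
    (hw : w ∈ vertices (piComplex n)) (h : rho n v = rho n w) :
    v ∈ MulAction.orbit (palindromicTorelli n) w := by
  obtain ⟨φ, hφ⟩ := exists_torelli_of_image_rho_eq hw hv (by simp [h])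
  rw [Finset.map_singleton, Finset.singleton_inj] at hφ
  exact ⟨φ, hφ⟩

theorem map_rho_piComplex : (piComplex n).map (rho n) = piComplexZ n := by
  ext s
  constructor
  · rintro ⟨t, ⟨hne, B, hB, htB⟩, rfl⟩
    refine ⟨hne.image _, _, hB.image_rho, ?_⟩
    rw [Finset.coe_image]
    exact Set.image_mono htB
  · rintro ⟨hne, C, hC, hsC⟩
    obtain ⟨D, hD, -, rfl⟩ := (isPiBasis_range (one_mem (palindromicAut n))).exists_lift
      (Set.empty_subset _) hC (by simp)
    obtain ⟨t, htD, rfl⟩ := Finset.subset_set_image_iff.1 hsC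
    exact ⟨t, ⟨Finset.image_nonempty.1 hne, D, hD, htD⟩, rfl⟩

end Quotient

end PalindromicTorelli

open PalindromicTorelli in
/-- The quotient of the complex of partial π-bases of `F_n` by the palindromic Torelli group is
isomorphic, as a simplicial complex, to the complex of partial π-bases of `ℤⁿ`, by an isomorphism
induced by abelianisation. The last two clauses say that the combinatorial quotient complex is
the genuine orbit space: distinct vertices of a simplex lie in distinct orbits, and two simplices
that have the same vertices in the quotient lie in the same orbit. -/
theorem mainTheorem7 (n : ℕ) :
    (∃ e : SimplicialIso
        (quotientComplex (palindromicTorelli n) (piComplex n) (actsSimplicially n))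
        (piComplexZ n),
      ∀ v : vertices (piComplex n),
        (e.toEquiv (quotientVertex (palindromicTorelli n) (piComplex n) (actsSimplicially n) v) :
          Fin n → ℤ) = rho n v) ∧
    (∀ s ∈ (piComplex n).faces, ∀ v ∈ s, ∀ w ∈ s,
      v ∈ MulAction.orbit (palindromicTorelli n) w → v = w) ∧
    (∀ s ∈ (piComplex n).faces, ∀ t ∈ (piComplex n).faces,
      (∀ v ∈ s, ∃ w ∈ t, v ∈ MulAction.orbit (palindromicTorelli n) w) →
      (∀ w ∈ t, ∃ v ∈ s, w ∈ MulAction.orbit (palindromicTorelli n) v) →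
      ∃ φ : palindromicTorelli n, s.map (MulAction.toPerm φ).toEmbedding = t) := by
  refine ⟨?_, ?_, ?_⟩
  · rw [← map_rho_piComplex]
    exact exists_simplicialIso_quotientComplex _ (fun φ => φ.2.2) fun v hv w hw =>
      mem_orbit_of_rho_eq hv hw
  · rintro s ⟨-, B, hB, hsB⟩ v hv w hw horb
    exact hB.injOn_rho (hsB hv) (hsB hw) (rho_eq_of_mem_orbit horb)
  · intro s hs t ht hst hts
    refine exists_torelli_of_image_rho_eq hs ht (Set.Subset.antisymm ?_ ?_)
    · rintro _ ⟨v, hv, rfl⟩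
      obtain ⟨w, hw, horb⟩ := hst v hv
      exact ⟨w, hw, (rho_eq_of_mem_orbit horb).symm⟩
    · rintro _ ⟨w, hw, rfl⟩
      obtain ⟨v, hv, horb⟩ := hts w hw
      exact ⟨v, hv, (rho_eq_of_mem_orbit horb).symm⟩
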